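/- Let $n_1,n_2,n_3,n_4$ be odd positive integers such that $S=\langle n_1,n_2,n_3,n_4\rangle=\{\sum_{i=1}^4 a_i n_i : a_i\in\mathbb N\}$ (with $0\in\mathbb N$) is a numerical semigroup, i.e. $\mathbb N\setminus S$ is finite. Let ${\rm PF}(S)=\{f\in\mathbb Z\setminus S : f+s\in S\text{ for all }s\in S\setminus\{0\}\}$ be its set of pseudo-Frobenius numbers, $t(S)=|{\rm PF}(S)|$ its type, ${\rm F}(S)=\max(\mathbb Z\setminus S)$ its Frobenius number and $g(S)=|\mathbb N\setminus S|$. Assume that $S$ is almost symmetric, i.e. $2g(S)={\rm F}(S)+t(S)$, and that $t(S)=3$. Then there is an integer $f$ such that $${\rm PF}(S)=\{f,2f,3f\},$$ and, after a suitable reordering of $n_1,n_2,n_3,n_4$ (the same for both matrices), the following matrices are RF-matrices of $f$ and of $2f$ respectively: $$\begin{pmatrix}-1&\alpha_2-1&0&0\\0&-1&\alpha_3-1&0\\0&0&-1&\alpha_4-1\\\alpha_1-1&0&0&-1\end{pmatrix},\qquad \begin{pmatrix}-1&\alpha_2-2&\alpha_3-1&0\\0&-1&\alpha_3-2&\alpha_4-1\\\alpha_1-1&0&-1&\alpha_4-2\\\alpha_1-2&\alpha_2-1&0&-1\end{pmatrix}.$$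 Here $\alpha_i$ is the least positive integer such that $\alpha_i n_i=\sum_{j\ne i}c_j n_j$ for some $c_j\in\mathbb N$, and an RF-matrix (row-factorization matrix) of $h\in{\rm PF}(S)$ is an integer matrix $(a_{ij})_{1\le i,j\le 4}$ with $a_{ii}=-1$ for all $i$, $a_{ij}\ge 0$ for all $i\neq j$, and $h=\sum_{j=1}^4 a_{ij}n_j$ for every $i$. -/

import Mathlib

namespace NumSemigroup

/-- A submonoid `S` of `ℕ` is a numerical semigroup if `ℕ \ S` is finite. -/
def IsNumericalSemigroup (S : AddSubmonoid ℕ) : Prop :=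
  ((S : Set ℕ)ᶜ).Finite

/-- The submonoid `⟨n_1, …, n_e⟩` of `ℕ` generated by a family of natural numbers. -/
def gen {e : ℕ} (n : Fin e → ℕ) : AddSubmonoid ℕ :=
  AddSubmonoid.closure (Set.range n)

/-- `S` viewed as a set of integers. -/
def intSet (S : AddSubmonoid ℕ) : Set ℤ :=
  {z | ∃ s ∈ S, (s : ℤ) = z}

/-- The Frobenius number `F(S)`, the maximum of `ℤ \ S`. For a numerical semigroup the set is
non-empty and bounded above, so the supremum is attained; for instance `F(ℕ) = -1`. -/
noncomputable def frobenius (S : AddSubmonoid ℕ) : ℤ :=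
  sSup {z : ℤ | z ∉ intSet S}

/-- The set `PF(S)` of pseudo-Frobenius numbers: the integers `f ∉ S` such that `f + s ∈ S`
for every `s ∈ S \ {0}`. -/
def PF (S : AddSubmonoid ℕ) : Set ℤ :=
  {f | f ∉ intSet S ∧ ∀ s ∈ S, s ≠ 0 → f + (s : ℤ) ∈ intSet S}

/-- The type `t(S)`, the cardinality of `PF(S)`. -/
noncomputable def type (S : AddSubmonoid ℕ) : ℕ :=
  (PF S).ncard

/-- The genus `g(S)`, the cardinality of `ℕ \ S`. -/
noncomputable def genus (S : AddSubmonoid ℕ) : ℕ :=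
  ((S : Set ℕ)ᶜ).ncard

/-- `S` is almost symmetric if `2 g(S) = F(S) + t(S)`. -/
def IsAlmostSymmetric (S : AddSubmonoid ℕ) : Prop :=
  2 * (genus S : ℤ) = frobenius S + (type S : ℤ)

/-- `α_i`, the least positive integer `a` such that `a n_i` is a combination of the `n_j`,
`j ≠ i`, with coefficients in `ℕ`. -/
noncomputable def alpha {e : ℕ} (n : Fin e → ℕ) (i : Fin e) : ℕ :=
  sInf {a : ℕ | 0 < a ∧ ∃ c : Fin e → ℕ, a * n i = ∑ j ∈ Finset.univ.erase i, c j * n j}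

/-- `A` is a row-factorization matrix of the pseudo-Frobenius number `f` of `⟨n_1, …, n_e⟩`:
its diagonal entries are `-1`, its other entries are non-negative integers, and
`f = ∑ j, A i j * n j` for every row `i`. -/
def IsRFMatrix {e : ℕ} (n : Fin e → ℕ) (f : ℤ) (A : Matrix (Fin e) (Fin e) ℤ) : Prop :=
  f ∈ PF (gen n) ∧ (∀ i, A i i = -1) ∧ (∀ i j, i ≠ j → 0 ≤ A i j) ∧
    ∀ i, f = ∑ j, A i j * (n j : ℤ)

/-- The first cyclic matrix, for `a = (α_1, α_2, α_3, α_4)`. -/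
def cyclicMatrix₁ (a : Fin 4 → ℤ) : Matrix (Fin 4) (Fin 4) ℤ :=
  !![-1, a 1 - 1, 0, 0;
     0, -1, a 2 - 1, 0;
     0, 0, -1, a 3 - 1;
     a 0 - 1, 0, 0, -1]

/-- The second cyclic matrix, for `a = (α_1, α_2, α_3, α_4)`. -/
def cyclicMatrix₂ (a : Fin 4 → ℤ) : Matrix (Fin 4) (Fin 4) ℤ :=
  !![-1, a 1 - 2, a 2 - 1, 0;
     0, -1, a 2 - 2, a 3 - 1;
     a 0 - 1, 0, -1, a 3 - 2;
     a 0 - 2, a 1 - 1, 0, -1]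

end NumSemigroup

namespace NumSemigroup

/-! Write F for the Frobenius number. Almost symmetry with type three makes F odd, gives PF(S) = {f,
g, F} with f + g = F, and makes f, g the only integers x with neither x nor F - x in S. By parity
one of the two, say f, is odd and g is even.

Draw an arrow i → j for f when f + n_i - n_j ∈ S, and likewise for g. For i ≠ j, exactly one of "i →
j for f" and "j → i for g" holds: both would put F in S, and the failure of both would make f + n_i
- n_j equal to f or g, which minimality of the generators and parity exclude
(`not_occurs_of_occurs`, `occurs_of_not_occurs`). Thus the digraph of g is the reversed complement
of that of f. If j is the only out-neighbour of i, then f + n_i = a n_j and no other generator can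
be subtracted from a n_j; this rigidity is `IsReducedMul`.

A finite check over all digraphs on four vertices (`digraphCheck_mkDigraph`) leaves five
configurations of only arrows. Three are impossible: a 2-cycle for g (`not_two_cycle_even`), a
2-cycle for f absorbing the g-arrows of the other two vertices (`not_two_cycle_odd`), and a chain of
an f-arrow and a g-arrow (`not_chain`). The parity behind the chain argument is that F + n_i is
twice an element of S, hence has a factorization with even coefficients. In the other two, a 4-cycle
for one of f, g forces the other to be its double (`eq_two_mul_of_four_cycle`); as f is odd, g = 2f.

On the 4-cycle f + n_i = a n_j, one has α_j = a + 1, which gives the first matrix; adding cyclically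
consecutive rows gives the second. -/

/-- The submonoid of `ℤ` generated by a finite family of integers. -/
def intSpan {e : ℕ} (n : Fin e → ℤ) : AddSubmonoid ℤ :=
  AddSubmonoid.closure (Set.range n)

/-! ### Factorizations in finitely generated submonoids of ℤ. -/

section Span

variable {e : ℕ} {n : Fin e → ℤ}

theorem gen_mem_intSpan (n : Fin e → ℤ) (i : Fin e) : n i ∈ intSpan n :=
  AddSubmonoid.subset_closure ⟨i, rfl⟩

theorem mul_mem_intSpan {x : ℤ} (hx : x ∈ intSpan n) (a : ℕ) : (a : ℤ) * x ∈ intSpan n := by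
  simpa using (intSpan n).nsmul_mem hx a

theorem mul_gen_mem_intSpan (n : Fin e → ℤ) (a : ℕ) (i : Fin e) : (a : ℤ) * n i ∈ intSpan n :=
  mul_mem_intSpan (gen_mem_intSpan n i) a

theorem mem_intSpan_iff {x : ℤ} : x ∈ intSpan n ↔ ∃ c : Fin e → ℕ, x = ∑ j, (c j : ℤ) * n j := by
  constructor
  · intro hx
    induction hx using AddSubmonoid.closure_induction with
    | mem x hx =>
      obtain ⟨i, rfl⟩ := hx
      exact ⟨fun j => if j = i then 1 else 0, by simp⟩
    | zero => exact ⟨0, by simp⟩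
    | add x y _ _ hx hy =>
      obtain ⟨c, rfl⟩ := hx
      obtain ⟨d, rfl⟩ := hy
      exact ⟨c + d, by simp [add_mul, Finset.sum_add_distrib]⟩
  · rintro ⟨c, rfl⟩
    exact (intSpan n).sum_mem fun j _ => mul_gen_mem_intSpan n (c j) j

/-- If `n j` occurs in a factorization, then it can be subtracted. -/
theorem sum_sub_gen_mem (c : Fin e → ℕ) (j : Fin e) (hj : 0 < c j) :
    ∑ k, (c k : ℤ) * n k - n j ∈ intSpan n := by
  rw [← Finset.add_sum_erase _ _ (Finset.mem_univ j)]
  obtain ⟨m, hm⟩ := Nat.exists_eq_succ_of_ne_zero hj.ne'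
  have h : ((c j : ℕ) : ℤ) * n j - n j = (m : ℤ) * n j := by rw [hm]; push_cast; ring
  have h2 : (c j : ℤ) * n j + ∑ x ∈ Finset.univ.erase j, (c x : ℤ) * n x - n j =
      (m : ℤ) * n j + ∑ x ∈ Finset.univ.erase j, (c x : ℤ) * n x := by linarith
  rw [h2]
  exact add_mem (mul_gen_mem_intSpan n m j)
    ((intSpan n).sum_mem fun k _ => mul_gen_mem_intSpan n (c k) k)

theorem dvd_of_mem_intSpan {d x : ℤ} (hd : ∀ i, d ∣ n i) (hx : x ∈ intSpan n) : d ∣ x := by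
  obtain ⟨c, rfl⟩ := mem_intSpan_iff.1 hx
  exact Finset.dvd_sum fun j _ => (hd j).mul_left _

end Span

/-! ### The two pseudo-Frobenius numbers f, g and their digraphs. -/

/-- The integers `f`, `g` are the two pseudo-Frobenius numbers other than the Frobenius number
`f + g` of an almost symmetric numerical semigroup of type three with odd generators `n`. -/
structure OddPair {e : ℕ} (n : Fin e → ℤ) (f g : ℤ) : Prop where
  pos : ∀ i, 0 < n i
  odd : ∀ i, Odd (n i)
  left_not_mem : f ∉ intSpan n
  right_not_mem : g ∉ intSpan n
  sum_not_mem : f + g ∉ intSpan n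
  left_add : ∀ s ∈ intSpan n, s ≠ 0 → f + s ∈ intSpan n
  right_add : ∀ s ∈ intSpan n, s ≠ 0 → g + s ∈ intSpan n
  dual : ∀ x, x ∈ intSpan n ∨ f + g - x ∈ intSpan n ∨ x = f ∨ x = g
  large : ∀ x, f + g < x → x ∈ intSpan n
  parity : Odd (f + g)

/-- No generator is redundant. -/
def IsMinimalGen {e : ℕ} (n : Fin (e + 1) → ℤ) : Prop :=
  ∀ i, n i ∉ intSpan (n ∘ i.succAbove)

/-- `n j` occurs in some factorization of `f + n i`. -/
def Occurs {e : ℕ} (n : Fin e → ℤ) (f : ℤ) (i j : Fin e) : Prop :=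
  f + n i - n j ∈ intSpan n

/-- `n j` is the only generator that occurs in the factorizations of `f + n i`. -/
def OnlyOccurs {e : ℕ} (n : Fin e → ℤ) (f : ℤ) (i j : Fin e) : Prop :=
  ∀ k, Occurs n f i k ↔ k = j

namespace OddPair

section Basic

variable {e : ℕ} {n : Fin e → ℤ} {f g : ℤ}

theorem swap (h : OddPair n f g) : OddPair n g f where
  pos := h.pos
  odd := h.odd
  left_not_mem := h.right_not_mem
  right_not_mem := h.left_not_mem
  sum_not_mem := by rw [add_comm]; exact h.sum_not_mem
  left_add := h.right_add
  right_add := h.left_add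
  dual x := by
    have := h.dual x
    rw [add_comm g f]
    tauto
  large x := by rw [add_comm]; exact h.large x
  parity := by rw [add_comm]; exact h.parity

theorem left_pos (h : OddPair n f g) : 0 < f := by
  rcases lt_trichotomy f 0 with hf | hf | hf
  · exact absurd (h.large g (by linarith)) h.right_not_mem
  · exact absurd (hf ▸ zero_mem _) h.left_not_mem
  · exact hf

theorem isUnit_of_dvd (h : OddPair n f g) {d : ℤ} (hd : ∀ i, d ∣ n i) : IsUnit d := by
  have h1 := dvd_of_mem_intSpan hd (h.large (f + g + 1) (by linarith))
  have h2 := dvd_of_mem_intSpan hd (h.large (f + g + 2) (by linarith))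
  have h3 := dvd_sub h2 h1
  rw [show f + g + 2 - (f + g + 1) = 1 by ring] at h3
  exact isUnit_of_dvd_one h3

theorem add_gen_mem (h : OddPair n f g) (i : Fin e) : f + n i ∈ intSpan n :=
  h.left_add _ (gen_mem_intSpan n i) (h.pos i).ne'

theorem not_occurs_self (h : OddPair n f g) (i : Fin e) : ¬ Occurs n f i i := by
  intro hi
  apply h.left_not_mem
  simpa [Occurs] using hi

theorem exists_occurs (h : OddPair n f g) (i : Fin e) : ∃ j, Occurs n f i j := by
  obtain ⟨c, hc⟩ := mem_intSpan_iff.1 (h.add_gen_mem i)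
  by_contra! hno
  have h0 : ∀ j, c j = 0 := by
    intro j
    by_contra hj
    apply hno j
    unfold Occurs
    rw [hc]
    exact sum_sub_gen_mem c j (Nat.pos_of_ne_zero hj)
  have : f + n i = 0 := by rw [hc]; simp [h0]
  linarith [h.left_pos, h.pos i]

/-- A nonzero s = f - g in S would give f = g + s ∈ S, and f = g would make f + g even. -/
theorem not_sub_mem (h : OddPair n f g) : f - g ∉ intSpan n := by
  intro hs
  by_cases h0 : f - g = 0
  · have := h.parity
    rw [show f + g = 2 * g by linarith] at this
    exact absurd (even_two_mul g) (Int.not_even_iff_odd.2 this)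
  · apply h.left_not_mem
    have := h.right_add _ hs h0
    rwa [show g + (f - g) = f by ring] at this

/-- A generator in the single-generator row is used with a positive coefficient, and no multiple
up to it can be rewritten. -/
theorem exists_mul_of_onlyOccurs (h : OddPair n f g) {i j : Fin e} (hij : OnlyOccurs n f i j) :
    ∃ a : ℕ, 0 < a ∧ f + n i = a * n j ∧ ∀ k, k ≠ j → (a : ℤ) * n j - n k ∉ intSpan n := by
  obtain ⟨c, hc⟩ := mem_intSpan_iff.1 (h.add_gen_mem i)
  have h0 : ∀ k, k ≠ j → c k = 0 := by
    intro k hk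
    by_contra hck
    apply hk
    apply (hij k).1
    unfold Occurs
    rw [hc]
    exact sum_sub_gen_mem c k (Nat.pos_of_ne_zero hck)
  have h1 : f + n i = c j * n j := by
    rw [hc]
    apply Finset.sum_eq_single j
    · intro k _ hk
      simp [h0 k hk]
    · simp
  refine ⟨c j, ?_, h1, ?_⟩
  · by_contra hcj
    have : c j = 0 := by omega
    rw [this] at h1
    have := h.left_pos
    have := h.pos i
    push_cast at h1
    linarith
  · intro k hk hmem
    exact hk ((hij k).1 (by unfold Occurs; rwa [h1]))

/-- Otherwise f + n_i and g + n_i are both multiples of n_j, so f - g or g - f lies in S. -/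
theorem not_onlyOccurs_both (h : OddPair n f g) {i j : Fin e} (hf : OnlyOccurs n f i j) :
    ¬ OnlyOccurs n g i j := by
  intro hg
  obtain ⟨a, -, ha, -⟩ := h.exists_mul_of_onlyOccurs hf
  obtain ⟨b, -, hb, -⟩ := h.swap.exists_mul_of_onlyOccurs hg
  rcases le_total a b with hab | hab
  · apply h.swap.not_sub_mem
    have : g - f = ((b - a : ℕ) : ℤ) * n j := by push_cast [hab]; linarith
    rw [this]
    exact mul_gen_mem_intSpan n _ j
  · apply h.not_sub_mem
    have : f - g = ((a - b : ℕ) : ℤ) * n j := by push_cast [hab]; linarith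
    rw [this]
    exact mul_gen_mem_intSpan n _ j

/-- Twice some element of the semigroup is `F + n i`, where `F = f + g`. -/
theorem exists_half (h : OddPair n f g) (i : Fin e) :
    ∃ w ∈ intSpan n, f + g + n i = 2 * w := by
  obtain ⟨w, hw⟩ := h.parity.add_odd (h.odd i)
  have hw2 : f + g + n i = 2 * w := by linarith
  refine ⟨w, ?_, hw2⟩
  rcases h.dual w with h1 | h1 | h1 | h1
  · exact h1
  · have := add_mem h1 (gen_mem_intSpan n i)
    rwa [show f + g - w + n i = w by linarith] at this
  · exact absurd (by rw [show f - g = n i by linarith]; exact gen_mem_intSpan n i) h.not_sub_mem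
  · exact absurd (by rw [show g - f = n i by linarith]; exact gen_mem_intSpan n i)
      h.swap.not_sub_mem

theorem not_occurs_of_occurs (h : OddPair n f g) {i j : Fin e} (hij : Occurs n f i j) :
    ¬ Occurs n g j i := by
  intro hji
  apply h.sum_not_mem
  have := add_mem hij hji
  rwa [show f + n i - n j + (g + n j - n i) = f + g by ring] at this

end Basic

/-! ### Duality of the two digraphs under minimality of the generators. -/

section Minimal

variable {e : ℕ} {n : Fin (e + 1) → ℤ} {f g : ℤ}

theorem gen_mem_succAbove {i k : Fin (e + 1)} (hk : k ≠ i) : n k ∈ intSpan (n ∘ i.succAbove) := by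
  obtain ⟨k, rfl⟩ := Fin.exists_succAbove_eq hk
  exact gen_mem_intSpan (n ∘ i.succAbove) k

/-- Apply `dual` to x = f + n_i - n_j. The value x = f means n_i = n_j, against minimality; x = g
would make f + g = 2f + (n_i - n_j) even. -/
theorem occurs_of_not_occurs (h : OddPair n f g) (hm : IsMinimalGen n) {i j : Fin (e + 1)}
    (hij : i ≠ j) (hn : ¬ Occurs n g j i) : Occurs n f i j := by
  rcases h.dual (f + n i - n j) with h1 | h1 | h1 | h1
  · exact h1
  · apply absurd _ hn
    unfold Occurs
    rwa [show g + n j - n i = f + g - (f + n i - n j) by ring]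
  · exact absurd (by rw [show n i = n j by linarith]; exact gen_mem_succAbove hij.symm) (hm i)
  · exfalso
    have h2 : f + g = 2 * f + (n i - n j) := by linarith
    have h3 := h.parity
    rw [h2] at h3
    exact Int.not_odd_iff_even.2 ((even_two_mul f).add ((h.odd i).sub_odd (h.odd j))) h3

/-- From f + n_i = a n_j and f + n_k = b n_j with b ≤ a follows n_i = n_k + (a - b) n_j, a
redundancy if i ≠ k. -/
theorem onlyOccurs_injective (h : OddPair n f g) (hm : IsMinimalGen n) {i j k : Fin (e + 1)}
    (hi : OnlyOccurs n f i j) (hk : OnlyOccurs n f k j) : i = k := by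
  have main : ∀ {i k : Fin (e + 1)} {a b : ℕ}, OnlyOccurs n f i j → i ≠ k → b ≤ a →
      f + n i = a * n j → f + n k = b * n j → False := by
    intro i k a b hi hik hab ha hb
    have hji : j ≠ i := by
      rintro rfl
      exact h.not_occurs_self j ((hi j).2 rfl)
    apply hm i
    have : n i = n k + ((a - b : ℕ) : ℤ) * n j := by push_cast [hab]; linarith
    rw [this]
    exact add_mem (gen_mem_succAbove hik.symm) (mul_mem_intSpan (gen_mem_succAbove hji) _)
  obtain ⟨a, -, ha, -⟩ := h.exists_mul_of_onlyOccurs hi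
  obtain ⟨b, -, hb, -⟩ := h.exists_mul_of_onlyOccurs hk
  by_contra hne
  rcases le_total b a with hab | hab
  · exact main hi hne hab ha hb
  · exact main hk (Ne.symm hne) hab hb ha

theorem reduce (h : OddPair n f g) (hm : ¬ IsMinimalGen n) :
    ∃ i : Fin (e + 1), OddPair (n ∘ i.succAbove) f g := by
  simp only [IsMinimalGen, not_forall, not_not] at hm
  obtain ⟨i, hi⟩ := hm
  have hs : intSpan (n ∘ i.succAbove) = intSpan n := by
    apply le_antisymm
    · apply AddSubmonoid.closure_mono
      rintro _ ⟨k, rfl⟩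
      exact ⟨_, rfl⟩
    · apply (AddSubmonoid.closure_le).2
      rintro _ ⟨k, rfl⟩
      by_cases hk : k = i
      · rw [hk]; exact hi
      · exact gen_mem_succAbove hk
  refine ⟨i, ?_⟩
  constructor
  · exact fun k => h.pos _
  · exact fun k => h.odd _
  all_goals try rw [hs]
  exacts [h.left_not_mem, h.right_not_mem, h.sum_not_mem, h.left_add, h.right_add, h.dual, h.large,
    h.parity]

end Minimal

/-! ### Fewer than four generators are impossible. -/

theorem not_fin_one {n : Fin 1 → ℤ} {f g : ℤ} : ¬ OddPair n f g := fun h => by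
  obtain ⟨j, hj⟩ := h.exists_occurs 0
  rw [Subsingleton.elim j 0] at hj
  exact h.not_occurs_self 0 hj

theorem not_fin_two {n : Fin 2 → ℤ} {f g : ℤ} : ¬ OddPair n f g := fun h => by
  by_cases hm : IsMinimalGen n
  · obtain ⟨j, hj⟩ := h.exists_occurs 0
    obtain ⟨k, hk⟩ := h.swap.exists_occurs 1
    have hj1 : j = 1 := by
      have : j ≠ 0 := by rintro rfl; exact h.not_occurs_self 0 hj
      omega
    have hk0 : k = 0 := by
      have : k ≠ 1 := by rintro rfl; exact h.swap.not_occurs_self 1 hk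
      omega
    subst hj1 hk0
    exact h.not_occurs_of_occurs hj hk
  · obtain ⟨i, hi⟩ := h.reduce hm
    exact not_fin_one hi

/-- On three vertices, if a digraph and its reversed complement both have an out-neighbour at every
vertex, then some vertex has the same only out-neighbour in both, against `not_onlyOccurs_both`. -/
theorem not_fin_three {n : Fin 3 → ℤ} {f g : ℤ} : ¬ OddPair n f g := fun h => by
  classical
  by_cases hm : IsMinimalGen n
  · have key : ∀ a b c d u v : Bool,
        let R : Fin 3 → Fin 3 → Bool := ![![false, a, b], ![c, false, d], ![u, v, false]]
        (∀ i, ∃ j, R i j = true) → (∀ j, ∃ i, i ≠ j ∧ R i j = false) →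
          ∃ i j, ∀ k, (R i k = true ↔ k = j) ∧ ((k ≠ i ∧ R k i = false) ↔ k = j) := by
      decide
    have hR : ∀ i j, (![![false, decide (Occurs n f 0 1), decide (Occurs n f 0 2)],
        ![decide (Occurs n f 1 0), false, decide (Occurs n f 1 2)],
        ![decide (Occurs n f 2 0), decide (Occurs n f 2 1), false]] : Fin 3 → Fin 3 → Bool) i j =
        decide (Occurs n f i j) := by
      intro i j
      have := h.not_occurs_self
      fin_cases i <;> fin_cases j <;> simp [this]
    have hg : ∀ i k, (k ≠ i ∧ ¬ Occurs n f k i) ↔ Occurs n g i k := by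
      intro i k
      constructor
      · rintro ⟨hk, ho⟩
        exact h.swap.occurs_of_not_occurs hm hk.symm ho
      · intro ho
        refine ⟨?_, h.swap.not_occurs_of_occurs ho⟩
        rintro rfl
        exact h.swap.not_occurs_self _ ho
    have := key _ _ _ _ _ _
      (fun i => by
        obtain ⟨j, hj⟩ := h.exists_occurs i
        exact ⟨j, by rw [hR]; simpa using hj⟩)
      (fun i => by
        obtain ⟨j, hj⟩ := h.swap.exists_occurs i
        refine ⟨j, ?_⟩
        rw [hR]
        simpa using (hg i j).2 hj)
    obtain ⟨i, j, hij⟩ := this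
    simp only [hR, decide_eq_true_eq, decide_eq_false_iff_not, hg] at hij
    exact h.not_onlyOccurs_both (fun k => (hij k).1) (fun k => (hij k).2)
  · obtain ⟨i, hi⟩ := h.reduce hm
    exact not_fin_two hi

/-- A redundant generator could be dropped without changing the semigroup, leaving three generators.
-/
theorem isMinimalGen {n : Fin 4 → ℤ} {f g : ℤ} (h : OddPair n f g) : IsMinimalGen n := by
  by_contra hm
  obtain ⟨i, hi⟩ := h.reduce hm
  exact not_fin_three hi

end OddPair

/-! ### Factorizations over four generators and reduced multiples. -/

theorem sub_gen_mem {e : ℕ} {n : Fin e → ℤ} {x y : ℤ} {a : ℕ} {i : Fin e} (ha : 0 < a)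
    (hy : y ∈ intSpan n) (hx : x = a * n i + y) : x - n i ∈ intSpan n := by
  have : x - n i = ((a - 1 : ℕ) : ℤ) * n i + y := by
    rw [hx]; push_cast [Nat.one_le_iff_ne_zero.2 ha.ne']; ring
  rw [this]
  exact add_mem (mul_gen_mem_intSpan n _ i) hy

theorem toFinset_eq_univ {i j k l : Fin 4} (hd : [i, j, k, l].Nodup) :
    [i, j, k, l].toFinset = Finset.univ := by
  apply Finset.eq_univ_of_card
  rw [List.toFinset_card_of_nodup hd]
  rfl

theorem eq_of_nodup {i j k l : Fin 4} (hd : [i, j, k, l].Nodup) (m : Fin 4) :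
    m = i ∨ m = j ∨ m = k ∨ m = l := by
  have := Finset.mem_univ m
  rw [← toFinset_eq_univ hd] at this
  simpa using this

theorem sum_fin_four {i j k l : Fin 4} (hd : [i, j, k, l].Nodup) (F : Fin 4 → ℤ) :
    ∑ t, F t = F i + F j + F k + F l := by
  rw [← toFinset_eq_univ hd, List.sum_toFinset _ hd]
  simp [add_assoc]

theorem nodup_rotate {i j k l : Fin 4} (hd : [i, j, k, l].Nodup) : [j, k, l, i].Nodup := by
  simp at hd ⊢
  tauto

theorem nodup_ne {i j k l : Fin 4} (hd : [i, j, k, l].Nodup) : k ≠ j ∧ l ≠ j ∧ k ≠ l := by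
  simp at hd ⊢
  tauto

section Four

variable {n : Fin 4 → ℤ} {f g : ℤ} {i j k l : Fin 4}

theorem exists_coeff (hd : [i, j, k, l].Nodup) {x : ℤ} (hx : x ∈ intSpan n) :
    ∃ a b c d : ℕ, x = a * n i + b * n j + c * n k + d * n l := by
  obtain ⟨c, rfl⟩ := mem_intSpan_iff.1 hx
  exact ⟨c i, c j, c k, c l, sum_fin_four hd _⟩

theorem mul_add_mul_mem (n : Fin 4 → ℤ) (a b : ℕ) (i j : Fin 4) :
    (a : ℤ) * n i + b * n j ∈ intSpan n :=
  add_mem (mul_gen_mem_intSpan n a i) (mul_gen_mem_intSpan n b j)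

theorem mul_add_mul_add_mul_mem (n : Fin 4 → ℤ) (a b c : ℕ) (i j k : Fin 4) :
    (a : ℤ) * n i + b * n j + c * n k ∈ intSpan n :=
  add_mem (mul_add_mul_mem n a b i j) (mul_gen_mem_intSpan n c k)

/-- A factorization avoiding the generators that cannot be subtracted. -/
theorem exists_coeff_three (hd : [i, j, k, l].Nodup) {x : ℤ} (hx : x ∈ intSpan n)
    (hi : x - n i ∉ intSpan n) : ∃ b c d : ℕ, x = b * n j + c * n k + d * n l := by
  obtain ⟨a, b, c, d, h⟩ := exists_coeff hd hx
  rcases Nat.eq_zero_or_pos a with rfl | ha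
  · exact ⟨b, c, d, by rw [h]; push_cast; ring⟩
  · exact absurd (sub_gen_mem ha (mul_add_mul_add_mul_mem n b c d j k l) (by rw [h]; ring)) hi

theorem exists_coeff_two (hd : [i, j, k, l].Nodup) {x : ℤ} (hx : x ∈ intSpan n)
    (hi : x - n i ∉ intSpan n) (hj : x - n j ∉ intSpan n) :
    ∃ c d : ℕ, x = c * n k + d * n l := by
  obtain ⟨b, c, d, h⟩ := exists_coeff_three hd hx hi
  rcases Nat.eq_zero_or_pos b with rfl | hb
  · exact ⟨c, d, by rw [h]; push_cast; ring⟩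
  · exact absurd (sub_gen_mem hb (mul_add_mul_mem n c d k l) (by rw [h]; ring)) hj

/-- No multiple of `n j` up to `a` times involves another generator in a factorization. -/
def IsReducedMul (n : Fin 4 → ℤ) (j : Fin 4) (a : ℕ) : Prop :=
  ∀ k, k ≠ j → (a : ℤ) * n j - n k ∉ intSpan n

theorem IsReducedMul.mono {a b : ℕ} (h : IsReducedMul n j a) (hb : b ≤ a) :
    IsReducedMul n j b := by
  intro k hk hmem
  apply h k hk
  have := add_mem hmem (mul_gen_mem_intSpan n (a - b) j)
  push_cast [hb] at this
  rwa [show (b : ℤ) * n j - n k + (a - b) * n j = a * n j - n k by ring] at this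

theorem IsReducedMul.eq_zero {a b : ℕ} (h : IsReducedMul n j a) (hk : k ≠ j) {y : ℤ}
    (hy : y ∈ intSpan n) (he : (a : ℤ) * n j = b * n k + y) : b = 0 := by
  by_contra hb
  exact h k hk (sub_gen_mem (Nat.pos_of_ne_zero hb) hy he)

/-- Comparison of a reduced two-generator expression with another factorization. -/
theorem eq_or_pos_of_isReducedMul (hpos : ∀ i, 0 < n i) (hd : [i, j, k, l].Nodup)
    {p q b c d : ℕ} (hp : IsReducedMul n j p) (hq : IsReducedMul n k q)
    (he : (p : ℤ) * n j + q * n k = b * n j + c * n k + d * n l) :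
    (b = p ∧ c = q ∧ d = 0) ∨
      (b ≤ p ∧ c ≤ q ∧ 0 < d ∧ (d : ℤ) * n l = (p - b : ℕ) * n j + (q - c : ℕ) * n k) := by
  have hjk : j ≠ k := by simp at hd; tauto
  rcases le_or_gt b p with hb | hb <;> rcases le_or_gt c q with hc | hc
  · have e : (d : ℤ) * n l = (p - b : ℕ) * n j + (q - c : ℕ) * n k := by
      push_cast [hb, hc]; linarith
    rcases Nat.eq_zero_or_pos d with rfl | h0
    · left
      have h1 : 0 ≤ ((p - b : ℕ) : ℤ) * n j := mul_nonneg (by positivity) (hpos j).le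
      have h2 : 0 ≤ ((q - c : ℕ) : ℤ) * n k := mul_nonneg (by positivity) (hpos k).le
      rw [Nat.cast_zero, zero_mul] at e
      have h3 : ((p - b : ℕ) : ℤ) * n j = 0 := by linarith
      have h4 : ((q - c : ℕ) : ℤ) * n k = 0 := by linarith
      have h5 := (mul_eq_zero.1 h3).resolve_right (hpos j).ne'
      have h6 := (mul_eq_zero.1 h4).resolve_right (hpos k).ne'
      omega
    · exact Or.inr ⟨hb, hc, h0, e⟩
  -- Here (p - b) n_j = (c - q) n_k + d n_l with c > q, so n_k can be subtracted from a reduced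
  -- multiple of n_j. The next case is its mirror image.
  · exfalso
    have := (hp.mono (Nat.sub_le p b)).eq_zero hjk.symm (b := c - q) (mul_gen_mem_intSpan n d l)
      (by push_cast [hb, hc.le]; linarith)
    omega
  · exfalso
    have := (hq.mono (Nat.sub_le q c)).eq_zero hjk (b := b - p) (mul_gen_mem_intSpan n d l)
      (by push_cast [hb.le, hc]; linarith)
    omega
  · exfalso
    have h1 : 0 < ((b : ℤ) - p) * n j := mul_pos (by omega) (hpos j)
    have h2 : 0 < ((c : ℤ) - q) * n k := mul_pos (by omega) (hpos k)
    have h3 : 0 ≤ (d : ℤ) * n l := mul_nonneg (by positivity) (hpos l).le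
    linarith

/-! ### Parity obstructions, and the 4-cycle. -/

namespace OddPair

theorem exists_isReducedMul (h : OddPair n f g) (hij : OnlyOccurs n f i j) :
    ∃ a : ℕ, 0 < a ∧ f + n i = a * n j ∧ IsReducedMul n j a :=
  h.exists_mul_of_onlyOccurs hij

theorem sum_add_sub_not_mem (h : OddPair n f g) (i : Fin 4) : f + g + n i - n i ∉ intSpan n := by
  rw [add_sub_cancel_right]; exact h.sum_not_mem

/-- The even factorization of `F + n i`. -/
theorem exists_even_coeff (h : OddPair n f g) (hd : [i, j, k, l].Nodup) :
    ∃ b c d : ℕ, f + g + n i =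
      (2 * b : ℕ) * n j + (2 * c : ℕ) * n k + (2 * d : ℕ) * n l := by
  obtain ⟨w, hw, h2⟩ := h.exists_half i
  have hwi : w - n i ∉ intSpan n := by
    intro hmem
    apply h.sum_not_mem
    rw [show f + g = w + (w - n i) by linarith]
    exact add_mem hw hmem
  obtain ⟨b, c, d, e⟩ := exists_coeff_three hd hw hwi
  exact ⟨b, c, d, by rw [h2, e]; push_cast; ring⟩

/-- The odd parity of the relation on `n l` forces even coefficients. -/
theorem not_odd_of_relation (h : OddPair n f g) (hd : [i, j, k, l].Nodup) {p q A x y z : ℕ}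
    (hp : IsReducedMul n j p) (hq : IsReducedMul n k q) (hpo : Odd p)
    (he : f + g + n i = p * n j + q * n k) (hA : Odd A) (hAr : IsReducedMul n l (A - 1))
    (hrel : (A : ℤ) * n l = x * n i + y * n j + z * n k) : False := by
  have hne : j ≠ l ∧ k ≠ l := by simp at hd; tauto
  -- Every factorization of F + n_i arises from p n_j + q n_k by r uses of the relation on n_l:
  -- while m ≥ A, trade A n_l for the right-hand side. The trade never produces n_i, since F ∉ S;
  -- below A the multiple m n_l is reduced, so m = 0.
  have key : ∀ m s t : ℕ, f + g + n i = s * n j + t * n k + m * n l →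
      ∃ r, m = r * A ∧ p = s + r * y := by
    intro m
    induction m using Nat.strong_induction_on with
    | _ m ih =>
      intro s t hst
      rcases lt_or_ge m A with hm | hm
      · rcases eq_or_pos_of_isReducedMul h.pos hd hp hq (he.symm.trans hst) with
          ⟨h1, -, h3⟩ | ⟨h1, h2, h3, h4⟩
        · exact ⟨0, by simp [h3], by simp [h1]⟩
        · exfalso
          have hr := hAr.mono (show m ≤ A - 1 by omega)
          have e1 := hr.eq_zero hne.1 (mul_gen_mem_intSpan n _ k) h4
          have e2 := hr.eq_zero hne.2 (mul_gen_mem_intSpan n _ j) (h4.trans (add_comm _ _))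
          rw [e1, e2] at h4
          have : 0 < (m : ℤ) * n l := mul_pos (by exact_mod_cast h3) (h.pos l)
          simp only [Nat.cast_zero, zero_mul, add_zero] at h4
          omega
      · have hst' : f + g + n i =
            x * n i + (((s + y : ℕ) : ℤ) * n j + ((t + z : ℕ) : ℤ) * n k +
              ((m - A : ℕ) : ℤ) * n l) := by
          rw [hst]; push_cast [hm]; linarith
        have hx : x = 0 := by
          by_contra hx
          exact h.sum_add_sub_not_mem i (sub_gen_mem (Nat.pos_of_ne_zero hx)
            (mul_add_mul_add_mul_mem n _ _ _ j k l) hst')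
        have hA0 := hA.pos
        obtain ⟨r, hr1, hr2⟩ := ih (m - A) (by omega) (s + y) (t + z) (by
          rw [hst', hx]; push_cast; ring)
        exact ⟨r + 1, by rw [add_mul]; omega, by rw [add_mul]; omega⟩
  -- For the even factorization rA is even with A odd, so r is even, and then p = 2b + r y is even.
  obtain ⟨b, c, d, hev⟩ := h.exists_even_coeff hd
  obtain ⟨r, h1, h2⟩ := key (2 * d) (2 * b) (2 * c) hev
  have hr : Even r := by
    have : Even (r * A) := h1 ▸ even_two_mul d
    exact (Nat.even_mul.1 this).resolve_right (Nat.not_even_iff_odd.2 hA)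
  have : Even p := h2 ▸ (even_two_mul b).add (hr.mul_right y)
  exact Nat.not_even_iff_odd.2 hpo this

/-- The same conclusion when `n l` is the only generator in the row of `i`. -/
theorem not_odd_of_onlyOccurs (h : OddPair n f g) (hd : [i, j, k, l].Nodup) {p q : ℕ}
    (hp : IsReducedMul n j p) (hq : IsReducedMul n k q) (hpo : Odd p)
    (he : f + g + n i = p * n j + q * n k) (hil : OnlyOccurs n g i l) : False := by
  have hd' : [i, l, j, k].Nodup := by simp at hd ⊢; tauto
  have hne : j ≠ l ∧ k ≠ l := by simp at hd; tauto
  obtain ⟨a, ha, hga, har⟩ := h.swap.exists_isReducedMul hil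
  have hoc : Occurs n g i l := (hil l).2 rfl
  obtain ⟨c, d, hcd⟩ := exists_coeff_two hd' (h.add_gen_mem l)
    (h.swap.not_occurs_of_occurs hoc) (h.not_occurs_self l)
  -- Add f + n_l and g + n_i = a n_l, then cancel one n_l.
  have hsum : (p : ℤ) * n j + q * n k = c * n j + d * n k + (a - 1 : ℕ) * n l := by
    push_cast [Nat.one_le_iff_ne_zero.2 ha.ne']
    linarith
  have hfl : f + n l = p * n j + q * n k := by
    rcases eq_or_pos_of_isReducedMul h.pos hd hp hq hsum with ⟨h1, h2, -⟩ | ⟨h1, h2, h3, h4⟩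
    · rw [hcd, h1, h2]
    · exfalso
      have hr := har.mono (Nat.sub_le a 1)
      have e1 := hr.eq_zero hne.1 (mul_gen_mem_intSpan n _ k) h4
      have e2 := hr.eq_zero hne.2 (mul_gen_mem_intSpan n _ j) (h4.trans (add_comm _ _))
      rw [e1, e2] at h4
      have : 0 < ((a - 1 : ℕ) : ℤ) * n l := mul_pos (by exact_mod_cast h3) (h.pos l)
      simp only [Nat.cast_zero, zero_mul, add_zero] at h4
      omega
  obtain ⟨b', c', d', hev⟩ := h.exists_even_coeff hd
  rcases eq_or_pos_of_isReducedMul h.pos hd hp hq (he.symm.trans hev) with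
    ⟨h1, -, -⟩ | ⟨-, -, h3, -⟩
  · exact Nat.not_even_iff_odd.2 hpo (h1 ▸ even_two_mul b')
  · apply h.left_not_mem
    have := sub_gen_mem h3 (mul_add_mul_mem n (2 * b') (2 * c') j k)
      (hev.trans (add_comm _ _))
    rwa [he, ← hfl, add_sub_cancel_right] at this

/-- A chain `i → j → k` of rows with a single generator, first for the odd `f` and then for the
even `g`, is impossible. -/
theorem not_chain (h : OddPair n f g) (hf : Odd f) (hd : [i, j, k, l].Nodup)
    (hij : OnlyOccurs n f i j) (hjk : OnlyOccurs n g j k)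
    (hl : (∃ m, OnlyOccurs n f m l) ∨ OnlyOccurs n g i l) : False := by
  obtain ⟨a, ha, hfa, har⟩ := h.exists_isReducedMul hij
  obtain ⟨b, hb, hgb, hbr⟩ := h.swap.exists_isReducedMul hjk
  have odd_pred : ∀ {m t : Fin 4} {c : ℕ}, f + n m = c * n t → Even c := by
    intro m t c hc
    have : Even ((c : ℤ) * n t) := hc ▸ hf.add_odd (h.odd m)
    have := (Int.even_mul.1 this).resolve_right (Int.not_even_iff_odd.2 (h.odd t))
    exact_mod_cast this
  have hao : Odd (a - 1) := by
    obtain ⟨r, hr⟩ := odd_pred hfa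
    exact ⟨r - 1, by omega⟩
  -- Sum of f + n_i = a n_j and g + n_j = b n_k with one n_j cancelled; a is even, so the
  -- coefficient a - 1 is odd.
  have he : f + g + n i = (a - 1 : ℕ) * n j + b * n k := by
    push_cast [Nat.one_le_iff_ne_zero.2 ha.ne']
    linarith
  rcases hl with ⟨m, hm⟩ | hl
  · obtain ⟨c, hc, hfc, hcr⟩ := h.exists_isReducedMul hm
    have hd' : [l, i, j, k].Nodup := by simp at hd ⊢; tauto
    obtain ⟨x, y, z, hxyz⟩ := exists_coeff_three hd' (h.add_gen_mem l) (h.not_occurs_self l)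
    have hml : m ≠ l := by
      rintro rfl
      exact h.not_occurs_self m ((hm m).2 rfl)
    -- From f + n_m = c n_l follows (c + 1) n_l = n_m + (f + n_l), whose right side is free of n_l.
    -- As c is even, c + 1 is odd.
    have hmem : ∃ x y z : ℕ, ((c + 1 : ℕ) : ℤ) * n l = x * n i + y * n j + z * n k := by
      have e : ((c + 1 : ℕ) : ℤ) * n l = n m + (x * n i + y * n j + z * n k) := by
        rw [← hxyz]; push_cast; linarith
      have hm3 : m = i ∨ m = j ∨ m = k := by
        have := eq_of_nodup hd m
        tauto
      rcases hm3 with rfl | rfl | rfl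
      · exact ⟨x + 1, y, z, by rw [e]; push_cast; ring⟩
      · exact ⟨x, y + 1, z, by rw [e]; push_cast; ring⟩
      · exact ⟨x, y, z + 1, by rw [e]; push_cast; ring⟩
    obtain ⟨x, y, z, hrel⟩ := hmem
    exact h.not_odd_of_relation hd (har.mono (Nat.sub_le a 1)) hbr hao he
      (odd_pred hfc).add_one hcr hrel
  · exact h.not_odd_of_onlyOccurs hd (har.mono (Nat.sub_le a 1)) hbr hao he hl

/-- For the even `g` there is no 2-cycle of rows with a single generator. -/
theorem not_two_cycle_even (h : OddPair n f g) (hg : Even g) (hij : OnlyOccurs n g i j)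
    (hji : OnlyOccurs n g j i) : False := by
  obtain ⟨a, ha, hga, har⟩ := h.swap.exists_isReducedMul hij
  obtain ⟨b, hb, hgb, hbr⟩ := h.swap.exists_isReducedMul hji
  have odd_coeff : ∀ {m t : Fin 4} {c : ℕ}, g + n m = c * n t → Odd c := by
    intro m t c hc
    have : Odd ((c : ℤ) * n t) := hc ▸ hg.add_odd (h.odd m)
    exact_mod_cast (Int.odd_mul.1 this).1
  obtain ⟨r, rfl⟩ := odd_coeff hga
  obtain ⟨s, rfl⟩ := odd_coeff hgb
  have hne : i ≠ j := by
    rintro rfl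
    exact h.swap.not_occurs_self i ((hij i).2 rfl)
  -- Both coefficients are odd, so the relation (2r + 2) n_j = (2s + 2) n_i can be halved, below the
  -- reduced bound 2r + 1.
  have := (har.mono (show r + 1 ≤ 2 * r + 1 by omega)).eq_zero hne (b := s + 1)
    (zero_mem _) (by push_cast at hga hgb ⊢; linarith)
  omega

/-- The difference `2f - g` when `f` has single-generator rows along `i → j → k → l`. -/
theorem exists_two_mul_sub (h : OddPair n f g) (hd : [i, j, k, l].Nodup) {a b c : ℕ} {m : ℤ}
    (hij : f + n i = a * n j) (hjk : f + n j = b * n k) (hkl : f + n k = c * n l)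
    (hc : 0 < c) (hli : Occurs n f l i) (hm : m = 2 * f - g) :
    ∃ β γ : ℕ, β < a ∧ γ ≤ b ∧ m = β * n j + γ * n k := by
  have hd' : [i, l, j, k].Nodup := by simp at hd ⊢; tauto
  have hnl := h.not_occurs_of_occurs hli
  obtain ⟨u, v, huv⟩ := exists_coeff_two hd' (h.swap.add_gen_mem i) (h.swap.not_occurs_self i) hnl
  have hu : u < a := by
    by_contra! hu
    apply h.swap.not_sub_mem
    have : g - f = (u - a : ℕ) * n j + v * n k := by push_cast [hu]; linarith
    rw [this]
    exact mul_add_mul_mem n _ v j k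
  -- Since (b + 1) n_k = n_j + c n_l, a larger v would make n_l occur in g + n_i, against the arrow
  -- l → i for f.
  have hv : v ≤ b := by
    by_contra! hv
    apply hnl
    refine sub_gen_mem hc (y := u * n j + ((v - b - 1 : ℕ) : ℤ) * n k + (1 : ℕ) * n j)
      (mul_add_mul_add_mul_mem n _ _ _ j k j) ?_
    have : ((v - b - 1 : ℕ) : ℤ) = v - b - 1 := by omega
    rw [huv, this]
    push_cast
    linarith
  refine ⟨a - 1 - u, b - v, by omega, by omega, ?_⟩
  have : ((a - 1 - u : ℕ) : ℤ) = a - 1 - u := by omega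
  rw [hm, this]
  push_cast [hv]
  linarith

/-- The cycle started at i and at j expresses 2f - g through n_j, n_k and through n_k, n_l. The
coefficients of n_j and n_l are within reduced bounds, so comparison leaves only n_k. -/
theorem exists_two_mul_sub_single (h : OddPair n f g) (hd : [i, j, k, l].Nodup)
    {a b c d : ℕ} (hij : f + n i = a * n j) (hjk : f + n j = b * n k) (hkl : f + n k = c * n l)
    (hli : f + n l = d * n i) (hc : 0 < c) (hd0 : 0 < d) (hoi : Occurs n f l i)
    (hoj : Occurs n f i j) (har : IsReducedMul n j a) (hcr : IsReducedMul n l c) :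
    ∃ γ : ℕ, γ ≤ b ∧ 2 * f - g = γ * n k := by
  obtain ⟨hne1, hne2, hne3⟩ := nodup_ne hd
  obtain ⟨β, γ, hβ, hγ, e⟩ := h.exists_two_mul_sub hd hij hjk hkl hc hoi rfl
  obtain ⟨β', γ', hβ', hγ', e'⟩ := h.exists_two_mul_sub (nodup_rotate hd) hjk hkl hli hd0 hoj rfl
  refine ⟨γ, hγ, ?_⟩
  rcases le_or_gt γ β' with hle | hlt
  · have e2 : (β : ℤ) * n j = (β' - γ : ℕ) * n k + γ' * n l := by
      push_cast [hle]; linarith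
    have hr := har.mono hβ.le
    have z1 := hr.eq_zero hne1 (mul_gen_mem_intSpan n _ l) e2
    have z2 := hr.eq_zero hne2 (mul_gen_mem_intSpan n _ k) (e2.trans (add_comm _ _))
    rw [z1, z2] at e2
    simp only [Nat.cast_zero, zero_mul, add_zero] at e2
    rw [e, e2, zero_add]
  · have := (hcr.mono hγ').eq_zero hne3 (b := γ - β') (mul_gen_mem_intSpan n β j)
      (by push_cast [hlt.le]; linarith)
    omega

/-- The single-generator expression and its rotation make 2f - g a reduced multiple of n_k and also
a multiple of n_l, hence zero. -/
theorem eq_two_mul_of_four_cycle (h : OddPair n f g) (hd : [i, j, k, l].Nodup)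
    (hij : OnlyOccurs n f i j) (hjk : OnlyOccurs n f j k) (hkl : OnlyOccurs n f k l)
    (hli : OnlyOccurs n f l i) : g = 2 * f := by
  obtain ⟨a, ha, hfa, har⟩ := h.exists_isReducedMul hij
  obtain ⟨b, hb, hfb, hbr⟩ := h.exists_isReducedMul hjk
  obtain ⟨c, hc, hfc, hcr⟩ := h.exists_isReducedMul hkl
  obtain ⟨d, hd0, hfd, hdr⟩ := h.exists_isReducedMul hli
  obtain ⟨γ, hγ, e⟩ := h.exists_two_mul_sub_single hd hfa hfb hfc hfd hc hd0
    ((hli i).2 rfl) ((hij j).2 rfl) har hcr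
  obtain ⟨γ', hγ', e'⟩ := h.exists_two_mul_sub_single (nodup_rotate hd) hfb hfc hfd hfa hd0 ha
    ((hij j).2 rfl) ((hjk k).2 rfl) hbr hdr
  have := (hbr.mono hγ).eq_zero (nodup_ne hd).2.2.symm (zero_mem _)
    (e.symm.trans (e'.trans (add_zero _).symm))
  rw [this] at e'
  simp only [Nat.cast_zero, zero_mul] at e'
  linarith

end OddPair

end Four

/-! ### Absorbing 2-cycles for the odd f. -/

namespace OddPair

variable {n : Fin 4 → ℤ} {f g : ℤ} {i j k l : Fin 4}

/-- Symmetry of the semigroup generated by `n i`, `n j`, with `f` as Frobenius number. -/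
theorem mem_or_sub_mem_of_two_cycle (h : OddPair n f g) (hne : i ≠ j) {b a : ℕ}
    (hfa : f + n i = a * n j) (hfb : f + n j = b * n i) (hbr : IsReducedMul n i b) {x : ℤ}
    (hx : (Int.gcd (n i) (n j) : ℤ) ∣ x) :
    (∃ s t : ℕ, x = s * n i + t * n j) ∨ ∃ s t : ℕ, f - x = s * n i + t * n j := by
  have hi := h.pos i
  have hj := h.pos j
  have hD : 0 < Int.gcd (n i) (n j) := Int.gcd_pos_of_ne_zero_left _ hi.ne'
  obtain ⟨p, q, hpq, hp, hq⟩ := Int.exists_gcd_one hD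
  set D : ℤ := (Int.gcd (n i) (n j) : ℤ) with hDdef
  have hD' : 0 < D := by rw [hDdef]; exact_mod_cast hD
  have hp0 : 0 < p := pos_of_mul_pos_left (hp ▸ hi) hD'.le
  have hq0 : 0 < q := pos_of_mul_pos_left (hq ▸ hj) hD'.le
  have hcop : IsCoprime q p := (Int.isCoprime_iff_gcd_eq_one.2 hpq).symm
  have e : ((b : ℤ) + 1) * p = (a + 1) * q := by
    have : (((b : ℤ) + 1) * p - (a + 1) * q) * D = 0 := by
      have e1 : ((b : ℤ) + 1) * n i = (a + 1) * n j := by linarith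
      rw [hp, hq] at e1
      linarith
    have := (mul_eq_zero.1 this).resolve_right hD'.ne'
    linarith
  have hdvd : q ∣ (b : ℤ) + 1 := hcop.dvd_of_dvd_mul_right ⟨a + 1, by rw [e]; ring⟩
  have hle : q ≤ (b : ℤ) + 1 := Int.le_of_dvd (by positivity) hdvd
  -- With n_i = pD and n_j = qD one has q n_i = p n_j, so q ≤ b would contradict reducedness. Hence
  -- f = (q - 1) n_i - n_j, which is D times the Frobenius number of ⟨p, q⟩.
  have hqb : q = (b : ℤ) + 1 := by
    by_contra hqb
    obtain ⟨q', rfl⟩ := Int.eq_ofNat_of_zero_le hq0.le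
    obtain ⟨p', rfl⟩ := Int.eq_ofNat_of_zero_le hp0.le
    have := (hbr.mono (show q' ≤ b by omega)).eq_zero hne.symm (b := p') (zero_mem _)
      (by rw [hp, hq]; ring)
    omega
  obtain ⟨A, B, hAB⟩ : ∃ A B : ℤ, x = n i * A + n j * B := by
    obtain ⟨y, rfl⟩ := hx
    refine ⟨Int.gcdA (n i) (n j) * y, Int.gcdB (n i) (n j) * y, ?_⟩
    rw [hDdef, Int.gcd_eq_gcd_ab]
    ring
  have hs0 := Int.emod_nonneg A hq0.ne'
  have hs1 := Int.emod_lt_of_pos A hq0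
  -- Normalize the coefficient of n_i to 0 ≤ s ≤ b = q - 1; the sign of the coefficient of n_j then
  -- decides between x and f - x.
  have hA := Int.emod_add_mul_ediv A q
  set s := A % q
  set r := A / q
  have hcomm : n j * p = n i * q := by
    have : n j * p = q * D * p := by rw [← hq]
    rw [this, hp]
    ring
  have hx3 : x = s * n i + (B + p * r) * n j := by
    rw [hAB, ← hA]
    linear_combination (-r) * hcomm
  rcases le_or_gt 0 (B + p * r) with ht | ht
  · refine Or.inl ⟨s.toNat, (B + p * r).toNat, ?_⟩
    rw [Int.toNat_of_nonneg hs0, Int.toNat_of_nonneg ht, hx3]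
  · refine Or.inr ⟨(b - s).toNat, (-1 - (B + p * r)).toNat, ?_⟩
    rw [Int.toNat_of_nonneg (by omega), Int.toNat_of_nonneg (by omega), hx3]
    linear_combination hfb

/-- Let D = gcd(n_i, n_j). Then g + n_i = u n_k + v n_l, and congruences modulo D and 2 make u + v
at least D. A partial sum X with D terms is divisible by D, so X or f - X lies in ⟨n_i, n_j⟩: the
first puts n_i or n_j into g + n_i, the second puts f into S. -/
theorem not_two_cycle_odd (h : OddPair n f g) (hg : Even g) (hd : [i, j, k, l].Nodup)
    (hij : OnlyOccurs n f i j) (hji : OnlyOccurs n f j i)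
    (hk : ∀ m, Occurs n g k m → m = i ∨ m = j) (hl : ∀ m, Occurs n g l m → m = i ∨ m = j) :
    False := by
  have hd1 : [k, l, i, j].Nodup := nodup_rotate (nodup_rotate hd)
  have hd2 : [l, k, i, j].Nodup := by
    clear hij hji hk hl
    simp at hd ⊢
    tauto
  obtain ⟨hki, hkj, hli, hlj, hne⟩ : k ≠ i ∧ k ≠ j ∧ l ≠ i ∧ l ≠ j ∧ i ≠ j := by
    clear hij hji hk hl hd1 hd2
    simp at hd ⊢
    tauto
  obtain ⟨a, ha, hfa, har⟩ := h.exists_isReducedMul hij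
  obtain ⟨b, hb, hfb, hbr⟩ := h.exists_isReducedMul hji
  have hgii := h.swap.not_occurs_self i
  have hgij : ¬ Occurs n g i j := h.not_occurs_of_occurs ((hji i).2 rfl)
  have notk : ∀ m, (m = k ∨ m = l) → ¬ (m = i ∨ m = j) := by
    rintro m (rfl | rfl) (rfl | rfl) <;> contradiction
  obtain ⟨c, d, hcd⟩ := exists_coeff_two hd1 (h.swap.add_gen_mem k)
    (fun ho => notk k (Or.inl rfl) (hk k ho)) (fun ho => notk l (Or.inr rfl) (hk l ho))
  obtain ⟨c', d', hcd'⟩ := exists_coeff_two hd2 (h.swap.add_gen_mem l)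
    (fun ho => notk l (Or.inr rfl) (hl l ho)) (fun ho => notk k (Or.inl rfl) (hl k ho))
  obtain ⟨u, v, huv⟩ := exists_coeff_two hd (h.swap.add_gen_mem i) hgii hgij
  have hsym := fun {x : ℤ} => h.mem_or_sub_mem_of_two_cycle hne hfa hfb hbr (x := x)
  have hDi := Int.gcd_dvd_left (n i) (n j)
  have hDj := Int.gcd_dvd_right (n i) (n j)
  have hDpos : 0 < Int.gcd (n i) (n j) := Int.gcd_pos_of_ne_zero_left _ (h.pos i).ne'
  generalize Int.gcd (n i) (n j) = D at hsym hDi hDj hDpos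
  have hgk : (D : ℤ) ∣ g + n k := hcd ▸ dvd_add (hDi.mul_left _) (hDj.mul_left _)
  have hgl : (D : ℤ) ∣ g + n l := hcd' ▸ dvd_add (hDi.mul_left _) (hDj.mul_left _)
  have hkl : (D : ℤ) ∣ n k - n l := by
    have := dvd_sub hgk hgl
    rwa [show g + n k - (g + n l) = n k - n l by ring] at this
  have hcop : IsCoprime (D : ℤ) (n k) := by
    rw [Int.isCoprime_iff_gcd_eq_one]
    have h1 := Int.gcd_dvd_left (D : ℤ) (n k)
    have h2 := Int.gcd_dvd_right (D : ℤ) (n k)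
    have := h.isUnit_of_dvd (d := (Int.gcd D (n k) : ℤ)) (by
      intro m
      rcases eq_of_nodup hd m with rfl | rfl | rfl | rfl
      · exact h1.trans hDi
      · exact h1.trans hDj
      · exact h2
      · have := dvd_sub h2 (h1.trans hkl)
        rwa [sub_sub_cancel] at this)
    exact_mod_cast Int.isUnit_iff_natAbs_eq.1 this
  -- Modulo D: n_i ≡ 0, n_l ≡ n_k and g ≡ -n_k, so (u + v + 1) n_k ≡ 0 with n_k invertible.
  have hdvd : D ∣ u + v + 1 := by
    have : (D : ℤ) ∣ ((u + v + 1 : ℕ) : ℤ) := by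
      apply hcop.dvd_of_dvd_mul_right
      have e : ((u + v + 1 : ℕ) : ℤ) * n k = v * (n k - n l) + (g + n k) + n i := by
        push_cast
        linear_combination -huv
      rw [e]
      exact dvd_add (dvd_add (hkl.mul_left _) hgk) hDi
    exact_mod_cast this
  have hDodd : Odd D := by
    obtain ⟨r, hr⟩ := hDi
    have := h.odd i
    rw [hr] at this
    exact_mod_cast (Int.odd_mul.1 this).1
  have heven : 2 ∣ u + v + 1 := by
    have h1 : Odd ((u : ℤ) * n k + v * n l) := huv ▸ hg.add_odd (h.odd i)
    have h2 := h.odd k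
    have h3 := h.odd l
    have : Even ((u + v + 1 : ℕ) : ℤ) := by
      push_cast
      simp only [Int.odd_add, Int.odd_mul, ← Int.not_odd_iff_even] at h1 ⊢
      simp [h2, h3] at h1 ⊢
      tauto
    exact even_iff_two_dvd.1 (by exact_mod_cast this)
  have h2D : 2 * D ≤ u + v + 1 :=
    Nat.le_of_dvd (by omega) (Nat.Coprime.mul_dvd_of_dvd_of_dvd
      (Nat.coprime_two_left.2 hDodd) heven hdvd)
  -- From 2D ≤ u + v + 1 and D ≥ 1 follows D ≤ u + v; divisibility by D alone would allow u + v = D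
  -- - 1.
  obtain ⟨u', v', hu', hv', huvD⟩ : ∃ u' v', u' ≤ u ∧ v' ≤ v ∧ u' + v' = D :=
    ⟨min u D, D - min u D, by omega, by omega, by omega⟩
  have hX : (D : ℤ) ∣ u' * n k + v' * n l := by
    have e : (u' : ℤ) * n k + v' * n l = D * n k - v' * (n k - n l) := by
      rw [← huvD]; push_cast; ring
    rw [e]
    exact dvd_sub (dvd_mul_right _ _) (hkl.mul_left _)
  have hXpos : 0 < (u' : ℤ) * n k + v' * n l := by
    have h1 := h.pos k
    have h2 := h.pos l
    rcases Nat.eq_zero_or_pos u' with h0 | h0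
    · have h3 : 0 < v' := by omega
      have : 0 < (v' : ℤ) * n l := mul_pos (by exact_mod_cast h3) h2
      have : 0 ≤ (u' : ℤ) * n k := mul_nonneg (by positivity) h1.le
      linarith
    · have : 0 < (u' : ℤ) * n k := mul_pos (by exact_mod_cast h0) h1
      have : 0 ≤ (v' : ℤ) * n l := mul_nonneg (by positivity) h2.le
      linarith
  have hrest := mul_add_mul_mem n (u - u') (v - v') k l
  have hsplit : g + n i = (u' * n k + v' * n l) +
      (((u - u' : ℕ) : ℤ) * n k + ((v - v' : ℕ) : ℤ) * n l) := by
    rw [huv]; push_cast [hu', hv']; ring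
  rcases hsym hX with ⟨s, t, hst⟩ | ⟨s, t, hst⟩
  · rw [hst] at hsplit hXpos
    rcases Nat.eq_zero_or_pos s with rfl | hs
    · rcases Nat.eq_zero_or_pos t with rfl | ht
      · simp at hXpos
      · exact hgij (sub_gen_mem ht hrest (by rw [hsplit]; push_cast; ring))
    · exact hgii (sub_gen_mem hs (add_mem (mul_gen_mem_intSpan n t j) hrest)
        (by rw [hsplit]; ring))
  · apply h.left_not_mem
    have := add_mem (mul_add_mul_mem n u' v' k l) (mul_add_mul_mem n s t i j)
    rwa [← hst, add_sub_cancel] at this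

end OddPair

/-! ### Classification of the digraphs on four vertices. -/

/-- One of four vertices satisfies `p`. -/
def anyFour (p : Fin 4 → Bool) : Bool := p 0 || (p 1 || (p 2 || p 3))

/-- All four vertices satisfy `p`. -/
def allFour (p : Fin 4 → Bool) : Bool := p 0 && (p 1 && (p 2 && p 3))

theorem anyFour_iff {p : Fin 4 → Bool} : anyFour p = true ↔ ∃ i, p i = true := by
  simp [anyFour, Fin.exists_fin_succ]

theorem allFour_iff {p : Fin 4 → Bool} : allFour p = true ↔ ∀ i, p i = true := by
  simp [allFour, Fin.forall_fin_succ]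

/-- The digraph on four vertices with given arrows. -/
def mkDigraph (a b c d p q r s t u v w : Bool) (i j : Fin 4) : Bool :=
  match i, j with
  | 0, 1 => a | 0, 2 => b | 0, 3 => c
  | 1, 0 => d | 1, 2 => p | 1, 3 => q
  | 2, 0 => r | 2, 1 => s | 2, 3 => t
  | 3, 0 => u | 3, 1 => v | 3, 2 => w
  | _, _ => false

/-- The reversed complement of a loopless digraph on four vertices. -/
def reverseCompl (R : Fin 4 → Fin 4 → Bool) (i j : Fin 4) : Bool :=
  i != j && !R j i

/-- The vertex `j` is the only out-neighbour of `i`. -/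
def onlyArrow (R : Fin 4 → Fin 4 → Bool) (i j : Fin 4) : Bool :=
  R i j && allFour fun k => k == j || !R i k

theorem onlyArrow_iff {R : Fin 4 → Fin 4 → Bool} {i j : Fin 4} :
    onlyArrow R i j = true ↔ ∀ k, R i k = true ↔ k = j := by
  simp only [onlyArrow, Bool.and_eq_true, allFour_iff, Bool.or_eq_true, beq_iff_eq,
    Bool.not_eq_true']
  constructor
  · rintro ⟨h1, h2⟩ k
    refine ⟨fun hk => (h2 k).resolve_right (by simp [hk]), ?_⟩
    rintro rfl
    exact h1
  · intro h
    refine ⟨(h j).2 rfl, fun k => ?_⟩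
    by_cases hk : k = j
    · exact Or.inl hk
    · exact Or.inr (by simpa [hk] using h k)

/-- There is a 4-cycle of only arrows. -/
def hasFourCycle (R : Fin 4 → Fin 4 → Bool) : Bool :=
  anyFour fun i => anyFour fun j => onlyArrow R i j && anyFour fun k => onlyArrow R j k &&
    anyFour fun l => onlyArrow R k l && (onlyArrow R l i && decide [i, j, k, l].Nodup)

/-- There is a 2-cycle of only arrows. -/
def hasTwoCycle (R : Fin 4 → Fin 4 → Bool) : Bool :=
  anyFour fun i => anyFour fun j => onlyArrow R i j && onlyArrow R j i

/-- There is a 2-cycle of only arrows of `R` to which all arrows of `T` from the other two vertices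
lead. -/
def hasAbsorbingTwoCycle (R T : Fin 4 → Fin 4 → Bool) : Bool :=
  anyFour fun i => anyFour fun j => onlyArrow R i j && (onlyArrow R j i &&
    anyFour fun k => anyFour fun l => decide [i, j, k, l].Nodup &&
      ((allFour fun m => !T k m || (m == i || m == j)) &&
        allFour fun m => !T l m || (m == i || m == j)))

/-- An only arrow of `R` is followed by an only arrow of `T`, and the remaining vertex is reached
by a suitable only arrow. -/
def hasChain (R T : Fin 4 → Fin 4 → Bool) : Bool :=
  anyFour fun i => anyFour fun j => onlyArrow R i j && anyFour fun k => onlyArrow T j k &&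
    anyFour fun l => decide [i, j, k, l].Nodup &&
      ((anyFour fun m => onlyArrow R m l) || onlyArrow T i l)

/-- Every vertex has an out-neighbour. -/
def hasArrows (R : Fin 4 → Fin 4 → Bool) : Bool :=
  allFour fun i => anyFour (R i)

/-- Distinct vertices have distinct only out-neighbours. -/
def hasDistinctArrows (R : Fin 4 → Fin 4 → Bool) : Bool :=
  allFour fun i => allFour fun j => !onlyArrow R i j ||
    allFour fun k => k == i || !onlyArrow R k j

/-- No vertex has the same only out-neighbour in both digraphs. -/
def hasDifferentArrows (R T : Fin 4 → Fin 4 → Bool) : Bool :=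
  allFour fun i => allFour fun j => !onlyArrow R i j || !onlyArrow T i j

/-- The classification of the possible supports of the rows. -/
def digraphCheck (R T : Fin 4 → Fin 4 → Bool) : Bool :=
  !(hasArrows R && (hasArrows T && (hasDistinctArrows R && (hasDistinctArrows T &&
    hasDifferentArrows R T)))) ||
  (hasFourCycle R || (hasFourCycle T || (hasTwoCycle T || (hasAbsorbingTwoCycle R T ||
    hasChain R T))))

/-- A loopless digraph on four vertices has twelve possible arrows, so this is a check of 2^12
cases. -/
theorem digraphCheck_mkDigraph : ∀ a b c d p q r s t u v w : Bool,
    digraphCheck (mkDigraph a b c d p q r s t u v w)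
      (reverseCompl (mkDigraph a b c d p q r s t u v w)) = true := by
  decide +kernel

theorem mkDigraph_eq (R : Fin 4 → Fin 4 → Bool) (hR : ∀ i, R i i = false) :
    mkDigraph (R 0 1) (R 0 2) (R 0 3) (R 1 0) (R 1 2) (R 1 3) (R 2 0) (R 2 1) (R 2 3) (R 3 0)
      (R 3 1) (R 3 2) = R := by
  funext i j
  fin_cases i <;> fin_cases j <;> simp [mkDigraph, hR]

theorem OddPair.exists_four_cycle {n : Fin 4 → ℤ} {f g : ℤ} (h : OddPair n f g) (hf : Odd f)
    (hg : Even g) : g = 2 * f ∧ ∃ i j k l, [i, j, k, l].Nodup ∧ OnlyOccurs n f i j ∧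
      OnlyOccurs n f j k ∧ OnlyOccurs n f k l ∧ OnlyOccurs n f l i := by
  classical
  have hm := h.isMinimalGen
  obtain ⟨R, hR⟩ : ∃ R : Fin 4 → Fin 4 → Bool, ∀ i j, R i j = true ↔ Occurs n f i j :=
    ⟨fun i j => decide (Occurs n f i j), fun i j => by simp⟩
  have hRi : ∀ i, R i i = false := fun i => by
    simpa using (hR i i).not.2 (h.not_occurs_self i)
  have hT : ∀ i j, reverseCompl R i j = true ↔ Occurs n g i j := by
    intro i j
    simp only [reverseCompl, Bool.and_eq_true, bne_iff_ne, Bool.not_eq_true']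
    rw [← Bool.not_eq_true, hR]
    constructor
    · rintro ⟨hij, ho⟩
      exact h.swap.occurs_of_not_occurs hm hij ho
    · intro ho
      refine ⟨?_, h.swap.not_occurs_of_occurs ho⟩
      rintro rfl
      exact h.swap.not_occurs_self _ ho
  have hRo : ∀ i j, onlyArrow R i j = true ↔ OnlyOccurs n f i j := by
    intro i j
    rw [onlyArrow_iff]
    exact forall_congr' fun k => by rw [hR]
  have hTo : ∀ i j, onlyArrow (reverseCompl R) i j = true ↔ OnlyOccurs n g i j := by
    intro i j
    rw [onlyArrow_iff]
    exact forall_congr' fun k => by rw [hT]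
  have key := digraphCheck_mkDigraph (R 0 1) (R 0 2) (R 0 3) (R 1 0) (R 1 2) (R 1 3) (R 2 0)
    (R 2 1) (R 2 3) (R 3 0) (R 3 1) (R 3 2)
  rw [mkDigraph_eq R hRi] at key
  have a1 : hasArrows R = true := by
    simp only [hasArrows, allFour_iff, anyFour_iff, hR]
    exact h.exists_occurs
  have a2 : hasArrows (reverseCompl R) = true := by
    simp only [hasArrows, allFour_iff, anyFour_iff, hT]
    exact h.swap.exists_occurs
  have a3 : hasDistinctArrows R = true := by
    simp only [hasDistinctArrows, allFour_iff, Bool.or_eq_true, Bool.not_eq_true', beq_iff_eq,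
      ← Bool.not_eq_true, hRo]
    intro i j
    by_cases hij : OnlyOccurs n f i j
    · refine Or.inr fun k => ?_
      by_cases hkj : OnlyOccurs n f k j
      · exact Or.inl (h.onlyOccurs_injective hm hkj hij)
      · exact Or.inr hkj
    · exact Or.inl hij
  have a4 : hasDistinctArrows (reverseCompl R) = true := by
    simp only [hasDistinctArrows, allFour_iff, Bool.or_eq_true, Bool.not_eq_true', beq_iff_eq,
      ← Bool.not_eq_true, hTo]
    intro i j
    by_cases hij : OnlyOccurs n g i j
    · refine Or.inr fun k => ?_
      by_cases hkj : OnlyOccurs n g k j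
      · exact Or.inl (h.swap.onlyOccurs_injective hm hkj hij)
      · exact Or.inr hkj
    · exact Or.inl hij
  have a5 : hasDifferentArrows R (reverseCompl R) = true := by
    simp only [hasDifferentArrows, allFour_iff, Bool.or_eq_true, Bool.not_eq_true',
      ← Bool.not_eq_true, hRo, hTo]
    intro i j
    by_cases hij : OnlyOccurs n f i j
    · exact Or.inr (h.not_onlyOccurs_both hij)
    · exact Or.inl hij
  simp only [digraphCheck, a1, a2, a3, a4, a5, Bool.and_self, Bool.not_true, Bool.false_or,
    Bool.or_eq_true, hasFourCycle, hasTwoCycle, hasAbsorbingTwoCycle, hasChain, anyFour_iff,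
    allFour_iff, Bool.and_eq_true, hRo, hTo, decide_eq_true_eq, beq_iff_eq, Bool.not_eq_true',
    ← Bool.not_eq_true, hT] at key
  rcases key with ⟨i, j, hij, k, hjk, l, hkl, hli, hd⟩ | ⟨i, j, hij, k, hjk, l, hkl, hli, hd⟩ |
    ⟨i, j, hij, hji⟩ | ⟨i, j, hij, hji, k, l, hd, hk, hl⟩ | ⟨i, j, hij, k, hjk, l, hd, hl⟩
  · exact ⟨h.eq_two_mul_of_four_cycle hd hij hjk hkl hli, i, j, k, l, hd, hij, hjk, hkl, hli⟩
  · exfalso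
    have := h.swap.eq_two_mul_of_four_cycle hd hij hjk hkl hli
    rw [this] at hf
    exact Int.not_even_iff_odd.2 hf (even_two_mul g)
  · exact (h.not_two_cycle_even hg hij hji).elim
  · exact (h.not_two_cycle_odd hg hd hij hji (fun m hm => (hk m).resolve_left (not_not.2 hm))
      fun m hm => (hl m).resolve_left (not_not.2 hm)).elim
  · exact (h.not_chain hf hd hij hjk hl).elim

/-! ### Counting gaps: from almost symmetry to the pair f, g. -/

section Frobenius

variable {S : AddSubmonoid ℕ}

theorem natCast_mem_intSet {m : ℕ} : (m : ℤ) ∈ intSet S ↔ m ∈ S := by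
  simp [intSet]

theorem add_mem_intSet {x y : ℤ} (hx : x ∈ intSet S) (hy : y ∈ intSet S) :
    x + y ∈ intSet S := by
  obtain ⟨s, hs, rfl⟩ := hx
  obtain ⟨t, ht, rfl⟩ := hy
  exact ⟨s + t, add_mem hs ht, by push_cast; rfl⟩

theorem nonneg_of_mem_intSet {x : ℤ} (hx : x ∈ intSet S) : 0 ≤ x := by
  obtain ⟨s, -, rfl⟩ := hx
  positivity

theorem bddAbove_compl_intSet (hS : IsNumericalSemigroup S) : BddAbove {z : ℤ | z ∉ intSet S} := by
  obtain ⟨b, hb⟩ := hS.bddAbove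
  refine ⟨b, fun z hz => ?_⟩
  rcases lt_or_ge z 0 with h | h
  · exact h.le.trans (by positivity)
  · obtain ⟨m, rfl⟩ := Int.eq_ofNat_of_zero_le h
    have : m ∈ (S : Set ℕ)ᶜ := fun hm => hz (natCast_mem_intSet.2 hm)
    exact_mod_cast hb this

theorem frobenius_not_mem (hS : IsNumericalSemigroup S) : frobenius S ∉ intSet S :=
  Int.csSup_mem (s := {z : ℤ | z ∉ intSet S})
    ⟨-1, fun h : (-1 : ℤ) ∈ intSet S => absurd (nonneg_of_mem_intSet h) (by norm_num)⟩
    (bddAbove_compl_intSet hS)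

theorem mem_of_frobenius_lt (hS : IsNumericalSemigroup S) {x : ℤ} (hx : frobenius S < x) :
    x ∈ intSet S := by
  by_contra h
  exact absurd (le_csSup (bddAbove_compl_intSet hS) h) (not_le.2 hx)

theorem neg_one_le_frobenius (hS : IsNumericalSemigroup S) : -1 ≤ frobenius S :=
  le_csSup (bddAbove_compl_intSet hS) fun h => absurd (nonneg_of_mem_intSet h) (by norm_num)

theorem frobenius_mem_PF (hS : IsNumericalSemigroup S) : frobenius S ∈ PF S := by
  refine ⟨frobenius_not_mem hS, fun s _ h0 => mem_of_frobenius_lt hS ?_⟩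
  have : 0 < s := Nat.pos_of_ne_zero h0
  omega

/-- The number of `x` with `x ∉ S`, `F - x ∉ S` is `2 g - F - 1`. -/
theorem ncard_gap_pairs (hS : IsNumericalSemigroup S) :
    {x : ℤ | x ∉ intSet S ∧ frobenius S - x ∉ intSet S}.Finite ∧
    ({x : ℤ | x ∉ intSet S ∧ frobenius S - x ∉ intSet S}.ncard : ℤ) =
      2 * genus S - frobenius S - 1 := by
  classical
  have hF := neg_one_le_frobenius hS
  have hlarge := fun {x : ℤ} => mem_of_frobenius_lt hS (x := x)
  have hneg : ∀ x : ℤ, x < 0 → x ∉ intSet S := fun x hx hm =>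
    absurd (nonneg_of_mem_intSet hm) (not_le.2 hx)
  have hFn := frobenius_not_mem hS
  generalize frobenius S = F at hF hlarge hFn
  set I := Finset.Icc 0 F
  have hI : ((Finset.card I : ℕ) : ℤ) = F + 1 := by
    simp only [I, Int.card_Icc]
    omega
  have hL : {x : ℤ | x ∉ intSet S ∧ F - x ∉ intSet S} =
      ↑((I.filter fun x => x ∉ intSet S).filter fun x => F - x ∉ intSet S) := by
    ext x
    simp only [Set.mem_ofPred_eq, Finset.coe_filter, Finset.mem_filter, I, Finset.mem_Icc]
    constructor
    · rintro ⟨h1, h2⟩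
      refine ⟨⟨⟨?_, ?_⟩, h1⟩, h2⟩
      · by_contra! h0
        exact h2 (hlarge (by linarith))
      · by_contra! h0
        exact h1 (hlarge h0)
    · tauto
  have hG : (genus S) = (I.filter fun x => x ∉ intSet S).card := by
    have himg : ((I.filter fun x => x ∉ intSet S : Finset ℤ) : Set ℤ) =
        (fun m : ℕ => (m : ℤ)) '' (S : Set ℕ)ᶜ := by
      ext x
      simp only [Finset.coe_filter, Set.mem_ofPred_eq, I, Finset.mem_Icc, Set.mem_image,
        Set.mem_compl_iff, SetLike.mem_coe]
      constructor
      · rintro ⟨⟨h0, -⟩, h2⟩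
        obtain ⟨m, rfl⟩ := Int.eq_ofNat_of_zero_le h0
        exact ⟨m, fun hm => h2 (natCast_mem_intSet.2 hm), rfl⟩
      · rintro ⟨m, hm, rfl⟩
        have : (m : ℤ) ∉ intSet S := fun h => hm (natCast_mem_intSet.1 h)
        refine ⟨⟨by positivity, ?_⟩, this⟩
        by_contra! h0
        exact this (hlarge h0)
    rw [genus, ← Set.ncard_image_of_injective _ (Nat.cast_injective (R := ℤ)), ← himg,
      Set.ncard_coe_finset]
  have h1 := Finset.card_filter_add_card_filter_not (s := I) (fun x => x ∈ intSet S)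
  have h2 := Finset.card_filter_add_card_filter_not (s := I.filter fun x => x ∉ intSet S)
    (fun x => F - x ∈ intSet S)
  -- The reflection x ↦ F - x matches the F + 1 - g(S) elements of S in [0, F] with the gaps whose
  -- mirror lies in S; the other gaps number g(S) - (F + 1 - g(S)).
  have h3 : (I.filter fun x => x ∈ intSet S).card =
      ((I.filter fun x => x ∉ intSet S).filter fun x => F - x ∈ intSet S).card := by
    refine Finset.card_bij' (fun x _ => F - x) (fun x _ => F - x) ?_ ?_ (by simp) (by simp)
    · intro x hx
      simp only [Finset.mem_filter, I, Finset.mem_Icc] at hx ⊢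
      refine ⟨⟨⟨by linarith, by linarith⟩, fun h => hFn ?_⟩, by simpa using hx.2⟩
      simpa using add_mem_intSet hx.2 h
    · intro x hx
      simp only [Finset.mem_filter, I, Finset.mem_Icc] at hx ⊢
      exact ⟨⟨by linarith, by linarith⟩, hx.2⟩
  rw [hL]
  refine ⟨Finset.finite_toSet _, ?_⟩
  rw [Set.ncard_coe_finset]
  omega

/-- The pseudo-Frobenius numbers of an almost symmetric semigroup of type three. -/
theorem exists_PF_eq (hS : IsNumericalSemigroup S) (hAS : IsAlmostSymmetric S)
    (ht : type S = 3) : Odd (frobenius S) ∧ ∃ f g : ℤ, f + g = frobenius S ∧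
      PF S = {frobenius S, f, g} ∧
      ∀ x, x ∉ intSet S → frobenius S - x ∉ intSet S → x = f ∨ x = g := by
  obtain ⟨hfin, hcard⟩ := ncard_gap_pairs hS
  have hFP := frobenius_mem_PF hS
  have hFn := frobenius_not_mem hS
  rw [IsAlmostSymmetric, ht] at hAS
  -- F = 2 g(S) - 3 = 2 (g(S) - 2) + 1.
  have hodd : Odd (frobenius S) := ⟨genus S - 2, by push_cast at hAS; linarith⟩
  refine ⟨hodd, ?_⟩
  set L := {x : ℤ | x ∉ intSet S ∧ frobenius S - x ∉ intSet S} with hL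
  have hsub : PF S \ {frobenius S} ⊆ L := by
    rintro x ⟨⟨hx, hadd⟩, hxF⟩
    refine ⟨hx, fun hmem => ?_⟩
    obtain ⟨s, hs, hsx⟩ := hmem
    have hs0 : s ≠ 0 := by
      rintro rfl
      apply hxF
      rw [Set.mem_singleton_iff]
      push_cast at hsx
      linarith
    have := hadd s hs hs0
    rw [hsx, add_sub_cancel] at this
    exact hFn this
  have hfinP : (PF S).Finite := Set.finite_of_ncard_ne_zero (by rw [← type, ht]; norm_num)
  have hc : (PF S \ {frobenius S}).ncard = 2 := by
    rw [Set.ncard_sdiff_singleton_of_mem hFP, ← type, ht]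
  have hLc : L.ncard = 2 := by
    push_cast at hAS
    omega
  have heq : PF S \ {frobenius S} = L := Set.eq_of_subset_of_ncard_le hsub (by omega) hfin
  obtain ⟨f, g, hfg, hLe⟩ := Set.ncard_eq_two.1 hLc
  have hfL : f ∈ L := by rw [hLe]; simp
  -- The two-element set L is stable under x ↦ F - x, which has no integer fixed point because F is
  -- odd; hence f and g are exchanged.
  have hFf : frobenius S - f ∈ L := ⟨hfL.2, by rw [sub_sub_cancel]; exact hfL.1⟩
  refine ⟨f, g, ?_, ?_, ?_⟩
  · rw [hLe] at hFf
    rcases hFf with h | h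
    · exfalso
      rw [show frobenius S = 2 * f by linarith] at hodd
      exact Int.not_even_iff_odd.2 hodd (even_two_mul f)
    · rw [Set.mem_singleton_iff] at h
      linarith
  · rw [← hLe, ← heq, Set.insert_sdiff_singleton, Set.insert_eq_of_mem hFP]
  · intro x h1 h2
    have : x ∈ L := ⟨h1, h2⟩
    rw [hLe] at this
    exact this

end Frobenius

/-! ### The numbers α and the two matrices. -/

theorem intSet_gen {e : ℕ} (n : Fin e → ℕ) :
    intSet (gen n) = intSpan fun i => (n i : ℤ) := by
  have : intSpan (fun i => (n i : ℤ)) = (gen n).map (Nat.castAddMonoidHom ℤ) := by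
    rw [gen, AddMonoidHom.map_mclosure, intSpan, ← Set.range_comp]
    rfl
  ext x
  rw [this]
  simp [intSet]

/-- The pseudo-Frobenius numbers other than the Frobenius number form an `OddPair`. -/
theorem exists_oddPair {n : Fin 4 → ℕ} (hS : IsNumericalSemigroup (gen n))
    (hAS : IsAlmostSymmetric (gen n)) (ht : type (gen n) = 3) (hodd : ∀ i, Odd (n i)) :
    ∃ f g : ℤ, OddPair (fun i => (n i : ℤ)) f g ∧ Odd f ∧ Even g ∧
      PF (gen n) = {f + g, f, g} := by
  obtain ⟨hF, f, g, hfg, hPF, hL⟩ := exists_PF_eq hS hAS ht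
  have hmem : ∀ x, x ∈ intSpan (fun i => (n i : ℤ)) ↔ x ∈ intSet (gen n) := fun x => by
    rw [intSet_gen]; rfl
  have hadd : ∀ p ∈ PF (gen n), ∀ s ∈ intSpan (fun i => (n i : ℤ)), s ≠ 0 →
      p + s ∈ intSpan (fun i => (n i : ℤ)) := by
    intro p hp s hs h0
    rw [hmem] at hs ⊢
    obtain ⟨t, ht, rfl⟩ := hs
    exact hp.2 t ht (by exact_mod_cast h0)
  have hf : f ∈ PF (gen n) := by rw [hPF]; simp
  have hg : g ∈ PF (gen n) := by rw [hPF]; simp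
  rw [← hfg] at hF hPF hL
  have pair : OddPair (fun i => (n i : ℤ)) f g :=
    { pos := fun i => by exact_mod_cast (hodd i).pos
      odd := fun i => by exact_mod_cast hodd i
      left_not_mem := by rw [hmem]; exact hf.1
      right_not_mem := by rw [hmem]; exact hg.1
      sum_not_mem := by rw [hmem, hfg]; exact frobenius_not_mem hS
      left_add := hadd f hf
      right_add := hadd g hg
      dual := fun x => by
        rw [hmem, hmem]
        have := hL x
        tauto
      large := fun x hx => by rw [hmem]; exact mem_of_frobenius_lt hS (hfg ▸ hx)
      parity := hF }
  rcases Int.even_or_odd g with h | h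
  · refine ⟨f, g, pair, ?_, h, hPF⟩
    rw [Int.odd_add] at hF
    exact hF.2 h
  · refine ⟨g, f, pair.swap, h, ?_, ?_⟩
    · rw [add_comm, Int.odd_add] at hF
      exact hF.1 h
    · rw [hPF, add_comm g f, Set.pair_comm]

theorem gen_comp_perm {e : ℕ} (n : Fin e → ℕ) (σ : Equiv.Perm (Fin e)) :
    gen (n ∘ σ) = gen n := by
  rw [gen, gen, σ.surjective.range_comp]

/-- `α_j` is one more than the largest reduced multiple. -/
theorem alpha_eq {n : Fin 4 → ℕ} {j : Fin 4} {a : ℕ}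
    (hr : IsReducedMul (fun i => (n i : ℤ)) j a) (hpos : 0 < n j)
    {c : Fin 4 → ℕ} (hc : (a + 1) * n j = ∑ k ∈ Finset.univ.erase j, c k * n k) :
    alpha n j = a + 1 := by
  apply le_antisymm
  · exact Nat.sInf_le ⟨by omega, c, hc⟩
  · refine le_csInf ⟨a + 1, by omega, c, hc⟩ ?_
    rintro b ⟨hb, d, hd⟩
    by_contra! hba
    have hr' := hr.mono (Nat.lt_succ_iff.1 hba)
    have hd' : (b : ℤ) * n j = ∑ k ∈ Finset.univ.erase j, (d k : ℤ) * n k := by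
      exact_mod_cast hd
    have h0 : ∀ k, k ≠ j → d k = 0 := by
      intro k hk
      refine hr'.eq_zero hk (y := ∑ t ∈ (Finset.univ.erase j).erase k, (d t : ℤ) * n t) ?_ ?_
      · exact sum_mem fun t _ => mul_gen_mem_intSpan (fun i => (n i : ℤ)) (d t) t
      · rw [hd', Finset.add_sum_erase _ (fun t => (d t : ℤ) * n t) (by simp [hk])]
    rw [Finset.sum_eq_zero] at hd
    · exact absurd hd (by positivity)
    · intro k hk
      rw [h0 k (Finset.ne_of_mem_erase hk), zero_mul]

theorem exists_perm_of_nodup {i j k l : Fin 4} (hd : [i, j, k, l].Nodup) :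
    ∃ σ : Equiv.Perm (Fin 4), σ 0 = i ∧ σ 1 = j ∧ σ 2 = k ∧ σ 3 = l := by
  have hinj : Function.Injective ![i, j, k, l] := by
    simp only [List.nodup_cons, List.mem_cons, not_or, List.not_mem_nil] at hd
    intro a b hab
    fin_cases a <;> fin_cases b <;> simp at hab ⊢ <;> simp [hab] at hd
  exact ⟨Equiv.ofBijective _ (Finite.injective_iff_bijective.1 hinj), rfl, rfl, rfl, rfl⟩

/-- The row-factorization matrices of an almost symmetric semigroup of type three with four odd
generators. -/
theorem exists_cyclic_rfMatrices (n : Fin 4 → ℕ)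
    (hS : IsNumericalSemigroup (gen n))
    (hAS : IsAlmostSymmetric (gen n))
    (htype : type (gen n) = 3)
    (hodd : ∀ i, Odd (n i)) :
    ∃ f : ℤ, PF (gen n) = {f, 2 * f, 3 * f} ∧
      ∃ σ : Equiv.Perm (Fin 4),
        IsRFMatrix (n ∘ σ) f
          (cyclicMatrix₁ fun i => (alpha (n ∘ σ) i : ℤ)) ∧
        IsRFMatrix (n ∘ σ) (2 * f)
          (cyclicMatrix₂ fun i => (alpha (n ∘ σ) i : ℤ)) := by
  obtain ⟨f, g, h, hf, hg, hPF⟩ := exists_oddPair hS hAS htype hodd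
  obtain ⟨rfl, i, j, k, l, hd, hij, hjk, hkl, hli⟩ := h.exists_four_cycle hf hg
  have hPF' : PF (gen n) = {f, 2 * f, 3 * f} := by
    rw [hPF, show f + 2 * f = 3 * f by ring]
    ext x
    simp only [Set.mem_insert_iff, Set.mem_singleton_iff]
    tauto
  refine ⟨f, hPF', ?_⟩
  obtain ⟨a₁, h1, e1, r1⟩ := h.exists_isReducedMul hij
  obtain ⟨a₂, h2, e2, r2⟩ := h.exists_isReducedMul hjk
  obtain ⟨a₃, h3, e3, r3⟩ := h.exists_isReducedMul hkl
  obtain ⟨a₀, h0, e0, r0⟩ := h.exists_isReducedMul hli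
  obtain ⟨σ, rfl, rfl, rfl, rfl⟩ := exists_perm_of_nodup hd
  have hr : ∀ t a, IsReducedMul (fun i => (n i : ℤ)) (σ t) a →
      IsReducedMul (fun i => ((n ∘ σ) i : ℤ)) t a := by
    intro t a ht s hs hmem
    rw [← SetLike.mem_coe, ← intSet_gen, gen_comp_perm, intSet_gen] at hmem
    exact ht (σ s) (fun he => hs (σ.injective he)) hmem
  have hp := fun t => (hodd (σ t)).pos
  -- After reordering, f + n_3 = a₀ n_0 and f + n_0 = a₁ n_1 give (a₀ + 1) n_0 = n_3 + a₁ n_1. The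
  -- other three relations are its rotations.
  have A0 : alpha (n ∘ σ) 0 = a₀ + 1 := alpha_eq (hr 0 _ r0) (hp 0) (c := ![0, a₁, 0, 1]) (by
    rw [show Finset.univ.erase (0 : Fin 4) = {1, 2, 3} by decide]
    simp
    zify
    linarith)
  have A1 : alpha (n ∘ σ) 1 = a₁ + 1 := alpha_eq (hr 1 _ r1) (hp 1) (c := ![1, 0, a₂, 0]) (by
    rw [show Finset.univ.erase (1 : Fin 4) = {0, 2, 3} by decide]
    simp
    zify
    linarith)
  have A2 : alpha (n ∘ σ) 2 = a₂ + 1 := alpha_eq (hr 2 _ r2) (hp 2) (c := ![0, 1, 0, a₃]) (by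
    rw [show Finset.univ.erase (2 : Fin 4) = {0, 1, 3} by decide]
    simp
    zify
    linarith)
  have A3 : alpha (n ∘ σ) 3 = a₃ + 1 := alpha_eq (hr 3 _ r3) (hp 3) (c := ![a₀, 0, 1, 0]) (by
    rw [show Finset.univ.erase (3 : Fin 4) = {0, 1, 2} by decide]
    simp
    zify
    linarith)
  refine ⟨σ, ⟨?_, ?_, ?_, ?_⟩, ?_, ?_, ?_, ?_⟩
  · rw [gen_comp_perm, hPF']; simp
  · intro t
    fin_cases t <;> simp [cyclicMatrix₁]
  · intro s t hst
    fin_cases s <;> fin_cases t <;> simp [cyclicMatrix₁, A0, A1, A2, A3] at hst ⊢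
  · intro t
    fin_cases t <;> simp [cyclicMatrix₁, A0, A1, A2, A3, Fin.sum_univ_four] <;> linarith
  · rw [gen_comp_perm, hPF']; simp
  · intro t
    fin_cases t <;> simp [cyclicMatrix₂]
  -- The entries α - 2 are nonnegative because each α is one more than a positive coefficient.
  · intro s t hst
    fin_cases s <;> fin_cases t <;> simp [cyclicMatrix₂, A0, A1, A2, A3] at hst ⊢ <;> omega
  -- Each row is the sum of two cyclically consecutive rows of the first matrix.
  · intro t
    fin_cases t <;> simp [cyclicMatrix₂, A0, A1, A2, A3, Fin.sum_univ_four] <;> linarith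

end NumSemigroup

theorem theorem5p2 (n : Fin 4 → ℕ)
    (hS : NumSemigroup.IsNumericalSemigroup (NumSemigroup.gen n))
    (hAS : NumSemigroup.IsAlmostSymmetric (NumSemigroup.gen n))
    (htype : NumSemigroup.type (NumSemigroup.gen n) = 3)
    (hodd : ∀ i, Odd (n i)) :
    ∃ f : ℤ, NumSemigroup.PF (NumSemigroup.gen n) = {f, 2 * f, 3 * f} ∧
      ∃ σ : Equiv.Perm (Fin 4),
        NumSemigroup.IsRFMatrix (n ∘ σ) f
          (NumSemigroup.cyclicMatrix₁ fun i => (NumSemigroup.alpha (n ∘ σ) i : ℤ)) ∧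
        NumSemigroup.IsRFMatrix (n ∘ σ) (2 * f)
          (NumSemigroup.cyclicMatrix₂ fun i => (NumSemigroup.alpha (n ∘ σ) i : ℤ)) :=
  NumSemigroup.exists_cyclic_rfMatrices n hS hAS htype hodd
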